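/- **Setting.** A *rooted graph* $(X,E)$ is a connected, locally finite simple graph with a fixed root $\vartheta$. Let $d$ be its graph distance, $|x|=d(\vartheta,x)$ and $X_n=\{x:|x|=n\}$. For $m\ge 0$ let $\mathcal J_m(x)$ be the set of all $y\in X_{|x|+m}$ such that $x$ lies on a geodesic from $\vartheta$ to $y$. An edge $(x,y)$ is *vertical* if $|x|-|y|=\pm1$ and *horizontal* if $|x|=|y|$; $E_v$ and $E_h$ are the sets of vertical and of horizontal edges, and $d_h$ is the graph distance of $(X,E_h)$ (with value $\infty$ where there is no horizontal path). The graph is *vertical* if $E=E_v$. It is *expansive* if $d_h(x,y)>1$ implies $d_h(u,v)>1$ for all $u\in\mathcal J_1(x)$, $v\in\mathcal J_1(y)$. Put $(x|y)=\frac12(|x|+|y|-d(x,y))$. The graph is *hyperbolic* if, for some $\delta\ge0$, $(x|y)\ge\min\{(x|z),(z|y)\}-\delta$ for all $x,y,z\in X$. In that case, for $a>0$ with $e^{\delta a}<\sqrt2$ for some such $\delta$, let $\theta_a(x,x)=0$ and, for $x\ne y$, $\theta_a(x,y)=\inf\sum_{i=1}^n e^{-a(x_{i-1}|x_i)}$ over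 all $n\ge1$ and all finite sequences $x=x_0,x_1,\dots,x_n=y$ in $X$. Let $\widehat X$ be the $\theta_a$-completion of $X$ and $\partial X=\widehat X\setminus X$ the *hyperbolic boundary*, with the extended metric $\theta_a$. Let $(X,E_v)$ be a vertical rooted graph with $\mathcal J_1(x)\neq\emptyset$ for all $x\in X$, and let $\mathcal R_v$ be the set of rays $\mathbf x=[x_i]_{i\ge0}$ with $x_0=\vartheta$ and $x_{i+1}\in\mathcal J_1(x_i)$ for all $i$. Let $(M,\rho)$ be a complete metric space; $|F|_\rho$ denotes the diameter of $F\subset M$ and $B(\xi,r)$ an open ball. An *index map* $\Phi$ assigns to each $x\in X$ a nonempty compact set $\Phi(x)\subset M$ such that $\Phi(y)\subset\Phi(x)$ whenever $y\in\mathcal J_1(x)$, and $\bigcap_{i}\Phi(x_i)$ is a singleton $\{\kappa_0(\mathbf x)\}$ for every $\mathbf x\in\mathcal R_v$. Its *attractor* is $K=\bigcap_{n\ge0}\bigcup_{x\in X_n}\Phi(x)$, and $K_x=\Phi(x)\cap K$. For $b>0$: - $\Phi$ is of *exponential type-$(b)$* if $|\Phi(x)|_\rho=O(e^{-b|x|})$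 as $|x|\to\infty$. - Condition $(S_b)$: for every $c>0$ there is $\bar\ell$ such that $\#\{x\in X_n:K_x\cap F\ne\emptyset\}\le\bar\ell$ for all $n\ge0$ and all $F\subset M$ with $|F|_\rho<ce^{-bn}$. - Condition $(B_b)$: there are a map $\iota:X\to K$ with $\iota(x)\in K_x$ for all $x$, and $c_0>0$, such that $B(\iota(x),c_0e^{-b|x|})\cap K\subset K_x$ for all $x\in X$. The space $(K,\rho)$ is *doubling* if for some integer $\ell$ every ball of radius $r>0$ in $K$ is covered by at most $\ell$ balls of radius $r/2$ in $K$. The *$AI_\infty$-graph* of $\Phi$ is $(X,E^{(\infty)})$, where $E^{(\infty)}$ consists of $E_v$ and all pairs $(x,y)$ with $|x|=|y|$, $x\neq y$ and $\Phi(x)\cap\Phi(y)\ne\emptyset$. A graph $(X,E)$ with vertical part $E_v$ is *admissible* (associated to $\Phi$) if it is expansive and hyperbolic, two rays in $\mathcal R_v$ converge to the same point of $\partial X$ if and only if they have the same image under $\kappa_0$, and the induced map $\kappa:\partial X\to K$, which sends $\xi$ to $\kappa_0(\mathbf x)$ for any ray $\mathbf x\in\mathcal R_v$ converging to $\xi$,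 is a well-defined bijection. **Theorem.** Let $\Phi$ be an index map on $(X,E_v)$ over $(M,\rho)$ with attractor $K$, of exponential type-$(b)$ for some $b>0$. Assume that either (i) condition $(S_b)$ is satisfied; or (ii) $(K,\rho)$ is doubling and condition $(B_b)$ is satisfied. Then the $AI_\infty$-graph $(X,E^{(\infty)})$ is hyperbolic, and it is an admissible graph. Moreover, for every $a>0$ as in the definition of its Gromov metric $\theta_a$, there is a constant $C>0$ such that the bijection $\kappa:\partial X\to K$ satisfies $$\rho(\kappa(\xi),\kappa(\eta))^{a/b}\le C\,\theta_a(\xi,\eta)\qquad\text{for all }\xi,\eta\in\partial X.$$ -/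

import Mathlib

open Filter Topology

namespace AugmentedIndexGraph

universe u v

/-! ### Rooted graphs

An edge set on `X` (a symmetric subset of `X × X` off the diagonal) is a `SimpleGraph X`; the
root is a vertex `o`. Countability of `X` is automatic for a connected locally finite graph. -/

section Graphs

variable {X : Type u}

/-- A rooted graph: connected and locally finite. -/
structure IsRooted (G : SimpleGraph X) : Prop where
  connected : G.Connected
  locallyFinite : ∀ x, (G.neighborSet x).Finite

/-- The level `|x|`, the graph distance from the root. -/
noncomputable def level (G : SimpleGraph X) (o x : X) : ℕ := G.dist o x

/-- The `m`-th descendant set of `x`: the vertices `y` of level `|x| + m` such that `x` lies on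
a geodesic from the root to `y`. -/
def descendants (G : SimpleGraph X) (o : X) (m : ℕ) (x : X) : Set X :=
  {y | level G o y = level G o x + G.dist x y ∧ level G o y = level G o x + m}

/-- The graph of vertical edges, joining vertices whose levels differ by one. -/
def verticalPart (G : SimpleGraph X) (o : X) : SimpleGraph X where
  Adj x y := G.Adj x y ∧ (level G o x = level G o y + 1 ∨ level G o y = level G o x + 1)
  symm := ⟨fun _ _ h => ⟨h.1.symm, h.2.symm⟩⟩
  loopless := ⟨fun _ h => G.loopless.irrefl _ h.1⟩

/-- The graph of horizontal edges, joining vertices of the same level. -/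
def horizontalPart (G : SimpleGraph X) (o : X) : SimpleGraph X where
  Adj x y := G.Adj x y ∧ level G o x = level G o y
  symm := ⟨fun _ _ h => ⟨h.1.symm, h.2.symm⟩⟩
  loopless := ⟨fun _ h => G.loopless.irrefl _ h.1⟩

/-- The horizontal distance, with value `⊤` if there is no horizontal path. -/
noncomputable def horizontalDist (G : SimpleGraph X) (o x y : X) : ℕ∞ :=
  (horizontalPart G o).edist x y

/-- A vertical rooted graph in which every vertex has at least one child. -/
structure IsVertical (V : SimpleGraph X) (o : X) : Prop where
  rooted : IsRooted V
  vertical : verticalPart V o = V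
  child : ∀ x, (descendants V o 1 x).Nonempty

/-- An expansive graph. -/
structure IsExpansive (G : SimpleGraph X) (o : X) : Prop where
  rooted : IsRooted G
  expansive : ∀ x y, 1 < horizontalDist G o x y →
    ∀ u ∈ descendants G o 1 x, ∀ w ∈ descendants G o 1 y, 1 < horizontalDist G o u w

/-- A geodesic ray starting from the root. -/
structure Ray (G : SimpleGraph X) (o : X) where
  vertex : ℕ → X
  vertex_zero : vertex 0 = o
  vertex_succ : ∀ i, vertex (i + 1) ∈ descendants G o 1 (vertex i)

theorem Ray.level_vertex {G : SimpleGraph X} {o : X} (x : Ray G o) (i : ℕ) :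
    level G o (x.vertex i) = i := by
  induction i with
  | zero => simp [x.vertex_zero, level]
  | succ i ih => rw [(x.vertex_succ i).2, ih]

/-! ### Hyperbolicity and the hyperbolic boundary -/

/-- The Gromov product with respect to the root. -/
noncomputable def gromovProduct (G : SimpleGraph X) (o x y : X) : ℝ :=
  ((level G o x : ℝ) + (level G o y : ℝ) - (G.dist x y : ℝ)) / 2

def IsHyperbolicWith (G : SimpleGraph X) (o : X) (δ : ℝ) : Prop :=
  0 ≤ δ ∧ ∀ x y z,
    min (gromovProduct G o x z) (gromovProduct G o z y) - δ ≤ gromovProduct G o x y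

/-- Gromov hyperbolicity. -/
def IsHyperbolic (G : SimpleGraph X) (o : X) : Prop := ∃ δ, IsHyperbolicWith G o δ

/-- The parameters `a > 0` of the Gromov metrics: `e ^ (δ a) < √2` for a constant `δ` of
hyperbolicity. -/
def IsGromovParameter (G : SimpleGraph X) (o : X) (a : ℝ) : Prop :=
  0 < a ∧ ∃ δ, IsHyperbolicWith G o δ ∧ Real.exp (δ * a) < √2

/-- The sums `∑ e ^ (-a (x_{i-1}|x_i))` along the finite chains from `x` to `y`. -/
def chainSums (G : SimpleGraph X) (o : X) (a : ℝ) (x y : X) : Set ℝ :=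
  {s | ∃ (n : ℕ) (c : ℕ → X), 1 ≤ n ∧ c 0 = x ∧ c n = y ∧
    s = ∑ i ∈ Finset.range n, Real.exp (-a * gromovProduct G o (c i) (c (i + 1)))}

open Classical in
/-- The Gromov metric `θ_a` on the set of vertices. -/
noncomputable def gromovDist (G : SimpleGraph X) (o : X) (a : ℝ) (x y : X) : ℝ :=
  if x = y then 0 else sInf (chainSums G o a x y)

theorem gromovProduct_comm (G : SimpleGraph X) (o x y : X) :
    gromovProduct G o x y = gromovProduct G o y x := by
  unfold gromovProduct
  rw [G.dist_comm]
  ring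

theorem chainSums_nonempty (G : SimpleGraph X) (o : X) (a : ℝ) (x y : X) :
    (chainSums G o a x y).Nonempty :=
  ⟨_, 1, fun i => if i = 0 then x else y, le_rfl, by simp, by simp, rfl⟩

theorem chainSums_nonneg {G : SimpleGraph X} {o : X} {a : ℝ} {x y : X} {s : ℝ}
    (hs : s ∈ chainSums G o a x y) : 0 ≤ s := by
  obtain ⟨n, c, -, -, -, rfl⟩ := hs
  positivity

theorem chainSums_bddBelow (G : SimpleGraph X) (o : X) (a : ℝ) (x y : X) :
    BddBelow (chainSums G o a x y) :=
  ⟨0, fun _ hs => chainSums_nonneg hs⟩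

theorem chainSums_comm_subset (G : SimpleGraph X) (o : X) (a : ℝ) (x y : X) :
    chainSums G o a x y ⊆ chainSums G o a y x := by
  rintro s ⟨n, c, hn, h0, h1, rfl⟩
  refine ⟨n, fun i => c (n - i), hn, by simpa using h1, by simpa using h0, ?_⟩
  rw [← Finset.sum_range_reflect]
  refine Finset.sum_congr rfl fun i hi => ?_
  have hi' := Finset.mem_range.1 hi
  rw [gromovProduct_comm]
  congr 3
  · congr 1
    omega
  · congr 1
    omega

theorem chainSums_add {G : SimpleGraph X} {o : X} {a : ℝ} {x y z : X} {s t : ℝ}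
    (hs : s ∈ chainSums G o a x y) (ht : t ∈ chainSums G o a y z) :
    s + t ∈ chainSums G o a x z := by
  obtain ⟨n, c, hn, h0, h1, rfl⟩ := hs
  obtain ⟨m, d, hm, g0, g1, rfl⟩ := ht
  refine ⟨n + m, fun i => if i ≤ n then c i else d (i - n), by omega, by simpa using h0, ?_, ?_⟩
  · have : ¬ n + m ≤ n := by omega
    simp [this, g1]
  · rw [Finset.sum_range_add]
    congr 1
    · refine Finset.sum_congr rfl fun i hi => ?_
      have hi' := Finset.mem_range.1 hi
      have h2 : i ≤ n := by omega
      have h3 : i + 1 ≤ n := by omega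
      simp [h2, h3]
    · refine Finset.sum_congr rfl fun i _ => ?_
      have h3 : ¬ n + i + 1 ≤ n := by omega
      have h4 : n + i + 1 - n = i + 1 := by omega
      rcases Nat.eq_zero_or_pos i with rfl | hi
      · simp [h1, g0]
      · have h2 : ¬ n + i ≤ n := by omega
        simp [h2, h3, h4]

theorem gromovDist_self (G : SimpleGraph X) (o : X) (a : ℝ) (x : X) :
    gromovDist G o a x x = 0 := by
  simp [gromovDist]

theorem gromovDist_comm (G : SimpleGraph X) (o : X) (a : ℝ) (x y : X) :
    gromovDist G o a x y = gromovDist G o a y x := by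
  have h : chainSums G o a x y = chainSums G o a y x :=
    Set.Subset.antisymm (chainSums_comm_subset G o a x y) (chainSums_comm_subset G o a y x)
  by_cases hxy : x = y
  · rw [hxy]
  · rw [gromovDist, gromovDist, if_neg hxy, if_neg (Ne.symm hxy), h]

theorem gromovDist_nonneg (G : SimpleGraph X) (o : X) (a : ℝ) (x y : X) :
    0 ≤ gromovDist G o a x y := by
  unfold gromovDist
  split_ifs
  · exact le_rfl
  · exact Real.sInf_nonneg fun _ hs => chainSums_nonneg hs

theorem gromovDist_triangle (G : SimpleGraph X) (o : X) (a : ℝ) (x y z : X) :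
    gromovDist G o a x z ≤ gromovDist G o a x y + gromovDist G o a y z := by
  by_cases hxz : x = z
  · subst hxz
    rw [gromovDist_self]
    exact add_nonneg (gromovDist_nonneg ..) (gromovDist_nonneg ..)
  by_cases hxy : x = y
  · subst hxy
    simp [gromovDist_self]
  by_cases hyz : y = z
  · subst hyz
    simp [gromovDist_self]
  unfold gromovDist
  rw [if_neg hxz, if_neg hxy, if_neg hyz]
  refine le_of_forall_pos_le_add fun ε hε => ?_
  obtain ⟨s, hs, hs'⟩ := Real.lt_sInf_add_pos (chainSums_nonempty G o a x y) (half_pos hε)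
  obtain ⟨t, ht, ht'⟩ := Real.lt_sInf_add_pos (chainSums_nonempty G o a y z) (half_pos hε)
  have := csInf_le (chainSums_bddBelow G o a x z) (chainSums_add hs ht)
  linarith

/-- The set of vertices, to be equipped with the Gromov metric `θ_a`. -/
def GromovSpace (_G : SimpleGraph X) (_o : X) (_a : ℝ) : Type u := X

/-- The (pseudo)metric structure of `θ_a`. For a rooted graph and `a > 0` it is a metric, since
`θ_a(x, y) ≥ e ^ (-a |x|)` for `x ≠ y`. -/
noncomputable instance gromovMetric (G : SimpleGraph X) (o : X) (a : ℝ) :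
    PseudoMetricSpace (GromovSpace G o a) where
  dist := gromovDist G o a
  dist_self := gromovDist_self G o a
  dist_comm := gromovDist_comm G o a
  dist_triangle := gromovDist_triangle G o a

/-- The completion of the set of vertices under `θ_a`. -/
abbrev GromovCompletion (G : SimpleGraph X) (o : X) (a : ℝ) : Type u :=
  UniformSpace.Completion (GromovSpace G o a)

/-- The canonical map from the vertices to the completion. -/
noncomputable def toCompletion (G : SimpleGraph X) (o : X) (a : ℝ) (x : X) : GromovCompletion G o a :=
  ((show GromovSpace G o a from x) : UniformSpace.Completion (GromovSpace G o a))

/-- The hyperbolic boundary: the points of the completion that are not vertices. As a subtype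
of the completion it carries the (extended) metric `θ_a`. -/
def boundary (G : SimpleGraph X) (o : X) (a : ℝ) : Set (GromovCompletion G o a) :=
  (Set.range (toCompletion G o a))ᶜ

/-- The sequence `x` of vertices converges to the boundary point `ξ`. -/
def ConvergesTo (G : SimpleGraph X) (o : X) (a : ℝ) (x : ℕ → X) (ξ : boundary G o a) : Prop :=
  Tendsto (fun i => toCompletion G o a (x i)) atTop (𝓝 (ξ : GromovCompletion G o a))

end Graphs

/-- A doubling metric space. -/
def IsDoubling (α : Type v) [MetricSpace α] : Prop :=
  ∃ N : ℕ, ∀ (ξ : α) (r : ℝ), 0 < r → ∃ s : Finset α, s.card ≤ N ∧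
    Metric.ball ξ r ⊆ ⋃ η ∈ s, Metric.ball η (r / 2)

/-! ### Index maps -/

section IndexMaps

variable {X : Type u} {M : Type v} [MetricSpace M]

/-- An index map on the vertical graph `V` over `M`. -/
structure IsIndexMap (V : SimpleGraph X) (o : X) (Φ : X → TopologicalSpace.NonemptyCompacts M) :
    Prop where
  subset : ∀ x, ∀ y ∈ descendants V o 1 x, (Φ y : Set M) ⊆ Φ x
  singleton : ∀ x : Ray V o, ∃ p : M, ⋂ i, (Φ (x.vertex i) : Set M) = {p}

/-- The attractor of an index map. -/
def attractor (V : SimpleGraph X) (o : X) (Φ : X → TopologicalSpace.NonemptyCompacts M) : Set M :=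
  ⋂ n : ℕ, ⋃ x ∈ {x | level V o x = n}, (Φ x : Set M)

/-- The cell `K_x` of the attractor. -/
def cell (V : SimpleGraph X) (o : X) (Φ : X → TopologicalSpace.NonemptyCompacts M) (x : X) :
    Set M :=
  (Φ x : Set M) ∩ attractor V o Φ

/-- The map `κ₀` sending a ray `[x_i]` to the unique point of `⋂ Φ(x_i)`. -/
noncomputable def kappaZero {V : SimpleGraph X} {o : X}
    {Φ : X → TopologicalSpace.NonemptyCompacts M} (h : IsIndexMap V o Φ) (x : Ray V o) :
    attractor V o Φ :=
  ⟨(h.singleton x).choose, by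
    have hp : (h.singleton x).choose ∈ ⋂ i, (Φ (x.vertex i) : Set M) := by
      exact (h.singleton x).choose_spec.ge rfl
    exact Set.mem_iInter.2 fun n =>
      Set.mem_biUnion (x := x.vertex n) (x.level_vertex n) (Set.mem_iInter.1 hp n)⟩

/-- Exponential type-`(b)`: the diameter of `Φ(x)` is `O(e ^ (-b |x|))` as `|x| → ∞`. -/
def IsExponentialType (V : SimpleGraph X) (o : X) (Φ : X → TopologicalSpace.NonemptyCompacts M)
    (b : ℝ) : Prop :=
  (fun x => Metric.diam (Φ x : Set M)) =O[comap (level V o) atTop]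
    fun x => Real.exp (-b * level V o x)

/-- Condition `(S_b)`. -/
def ConditionS (V : SimpleGraph X) (o : X) (Φ : X → TopologicalSpace.NonemptyCompacts M)
    (b : ℝ) : Prop :=
  ∀ c : ℝ, 0 < c → ∃ N : ℕ, ∀ (n : ℕ) (F : Set M),
    Metric.ediam F < ENNReal.ofReal (c * Real.exp (-b * n)) →
    {x | level V o x = n ∧ (cell V o Φ x ∩ F).Nonempty}.encard ≤ N

/-- Condition `(B_b)`. -/
def ConditionB (V : SimpleGraph X) (o : X) (Φ : X → TopologicalSpace.NonemptyCompacts M)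
    (b : ℝ) : Prop :=
  ∃ ι : X → M, (∀ x, ι x ∈ cell V o Φ x) ∧ ∃ c : ℝ, 0 < c ∧
    ∀ x, Metric.ball (ι x) (c * Real.exp (-b * level V o x)) ∩ attractor V o Φ ⊆ cell V o Φ x

/-- The augmented index graph of type-`(∞)`: the edges of `V` together with the horizontal edges
joining distinct vertices of the same level whose images under `Φ` intersect. -/
def intersectionGraph (V : SimpleGraph X) (o : X)
    (Φ : X → TopologicalSpace.NonemptyCompacts M) : SimpleGraph X where
  Adj x y := V.Adj x y ∨
    (level V o x = level V o y ∧ x ≠ y ∧ ((Φ x : Set M) ∩ Φ y).Nonempty)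
  symm := ⟨fun x y h => h.imp (fun e => e.symm) fun e =>
    ⟨e.1.symm, e.2.1.symm, by rw [Set.inter_comm]; exact e.2.2⟩⟩
  loopless := ⟨fun _ h => h.elim (fun e => V.loopless.irrefl _ e) fun e => e.2.1 rfl⟩

/-- `κ : ∂X → K` is the map induced by `κ₀`: every ray converges to a boundary point, every
boundary point is the limit of a ray, and `κ(ξ) = κ₀(x)` whenever the ray `x` converges to `ξ`.
There is at most one such map. Here `V` is the vertical part of `G`. -/
structure IsInducedMap {V : SimpleGraph X} (G : SimpleGraph X) {o : X}
    {Φ : X → TopologicalSpace.NonemptyCompacts M} (h : IsIndexMap V o Φ) (a : ℝ)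
    (κ : boundary G o a → attractor V o Φ) : Prop where
  exists_limit : ∀ x : Ray V o, ∃ ξ, ConvergesTo G o a x.vertex ξ
  exists_ray : ∀ ξ, ∃ x : Ray V o, ConvergesTo G o a x.vertex ξ
  eq_kappaZero : ∀ (x : Ray V o) (ξ), ConvergesTo G o a x.vertex ξ → κ ξ = kappaZero h x

/-- `G` is an admissible graph associated to the index map `Φ` on the vertical graph `V`: `G` is
an expansive hyperbolic graph with vertical part `V`, two rays converge to the same boundary
point if and only if they have the same image under `κ₀`, and `κ` is a well-defined bijection
of `∂X` onto the attractor. -/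
structure IsAdmissible (V G : SimpleGraph X) (o : X)
    (Φ : X → TopologicalSpace.NonemptyCompacts M) : Prop where
  expansive : IsExpansive G o
  hyperbolic : IsHyperbolic G o
  verticalPart_eq : verticalPart G o = V
  indexMap : IsIndexMap V o Φ
  equivalent_iff : ∀ a, IsGromovParameter G o a → ∀ x y : Ray V o,
    (∃ ξ, ConvergesTo G o a x.vertex ξ ∧ ConvergesTo G o a y.vertex ξ) ↔
      kappaZero indexMap x = kappaZero indexMap y
  bijective : ∀ a, IsGromovParameter G o a → ∃ κ : boundary G o a → attractor V o Φ,
    IsInducedMap G indexMap a κ ∧ Function.Bijective κ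

end IndexMaps

end AugmentedIndexGraph

/-!
Write `G` for the intersection graph. Its levels are those of `V`, and if `Φ x` meets `Φ y`, then
so do the images of all ancestors of `x` and `y`; this gives expansiveness at once.

Everything else rests on one observation about a geodesic of `G` from `x` to `y`. It never goes
below the level `(x|y)`, and its levels grow linearly away from the turning point. As `Φ` takes
intersecting values at neighbors and has diameters `O(e ^ (-b |x|))`, a geometric series shows that
the union of the sets `Φ z` along the geodesic has diameter `O(e ^ (-b (x|y)))`
(`exists_dist_le_of_mem_geodesic`).

* *Hyperbolicity.* For `n ≤ (x|y)` the ancestors of level `n` of the vertices of the geodesic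
  induce a connected subgraph of `G`, and their cells all meet a set of diameter `O(e ^ (-b n))`.
  Every second vertex on a shortest path of this subgraph gives a family with pairwise disjoint
  images under `Φ`. Both `(S_b)` and, by a packing argument, doubling with `(B_b)` bound the size
  of such families (`HasDisjointCellBound`). So ancestors of level `n ≤ (x|y)` of `x` and `y` are
  at distance at most some constant `N` (`exists_dist_ancestors_le`). Conversely, ancestors of
  level `n` within distance `N` force `(x|y) ≥ n - N / 2`. Hyperbolicity follows by the triangle
  inequality in `G`.
* *The map `κ`.* By Frink's lemma `θ_a(x, y)` is comparable to `e ^ (-a (x|y))` for `x ≠ y`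
  (`IsGromovParameter.exp_le_two_mul_gromovDist`), so the diameter bound, raised to the power
  `a / b`, becomes the Hölder estimate, which also shows that `κ` is well defined. Rays with the
  same image under `κ₀` stay within distance one of each other, so `κ` is injective. König's lemma,
  in the form `exists_ray_of_ultrafilter`, yields both that every boundary point is the limit of a
  ray and that `κ₀` is surjective.
-/

namespace AugmentedIndexGraph

/-! ### Ancestors and rays -/

section VerticalGraphs

variable {X : Type*} {V G : SimpleGraph X} {o : X}

theorem mem_descendants_one_iff {u v : X} :
    v ∈ descendants G o 1 u ↔ G.Adj u v ∧ level G o v = level G o u + 1 := by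
  rw [← SimpleGraph.dist_eq_one_iff_adj]
  simp only [descendants, Set.mem_ofPred_eq]
  omega

theorem level_le_add_dist (hG : G.Connected) (x y : X) :
    level G o x ≤ level G o y + G.dist x y := by
  have := hG.dist_triangle (u := o) (v := y) (w := x)
  rwa [G.dist_comm (u := y)] at this

/-- `u` is an ancestor of `x` if a descending path, possibly trivial, leads from `u` to `x`. -/
def IsAncestor (V : SimpleGraph X) (o : X) : X → X → Prop :=
  Relation.ReflTransGen fun u v => v ∈ descendants V o 1 u

theorem IsAncestor.dist_add_level (hG : G.Connected) (hle : V ≤ G) {u x : X}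
    (h : IsAncestor V o u x) : G.dist u x + level V o u ≤ level V o x := by
  induction h with
  | refl => simp
  | @tail v w _ h ih =>
    have h1 := SimpleGraph.dist_eq_one_iff_adj.2 (hle (mem_descendants_one_iff.1 h).1)
    have h2 := hG.dist_triangle (u := u) (v := v) (w := w)
    have := h.2
    omega

theorem exists_parent (hV : V.Connected) {x : X} {n : ℕ} (hx : level V o x = n + 1) :
    ∃ u, level V o u = n ∧ x ∈ descendants V o 1 u := by
  obtain ⟨p, hp⟩ := hV.exists_walk_length_eq_dist x o
  rw [V.dist_comm] at hp
  change p.length = level V o x at hp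
  cases p with
  | nil => simp at hp; omega
  | @cons _ u _ h q =>
    have h1 : level V o u ≤ q.length := by
      rw [level, V.dist_comm]; exact V.dist_le q
    have h2 := level_le_add_dist (o := o) hV x u
    rw [SimpleGraph.dist_eq_one_iff_adj.2 h] at h2
    rw [SimpleGraph.Walk.length_cons] at hp
    exact ⟨u, by omega, mem_descendants_one_iff.2 ⟨h.symm, by omega⟩⟩

theorem exists_ancestor (hV : V.Connected) {n : ℕ} :
    ∀ {x : X}, n ≤ level V o x → ∃ u, level V o u = n ∧ IsAncestor V o u x := by
  suffices H : ∀ k, ∀ x, level V o x = n + k → ∃ u, level V o u = n ∧ IsAncestor V o u x from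
    fun {x} h => H (level V o x - n) x (by omega)
  intro k
  induction k with
  | zero => exact fun x hx => ⟨x, hx, Relation.ReflTransGen.refl⟩
  | succ k ih =>
    intro x hx
    obtain ⟨v, hv, hvx⟩ := exists_parent hV (n := n + k) hx
    obtain ⟨u, hu, huv⟩ := ih v hv
    exact ⟨u, hu, huv.tail hvx⟩

theorem isAncestor_root (hV : V.Connected) (x : X) : IsAncestor V o o x := by
  obtain ⟨u, hu, h⟩ := exists_ancestor hV (o := o) (n := 0) (x := x) (Nat.zero_le _)
  rwa [← hV.dist_eq_zero_iff.1 hu] at h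

theorem finite_setOf_level_eq (hV : IsRooted V) (n : ℕ) : {x | level V o x = n}.Finite := by
  induction n with
  | zero =>
    refine (Set.finite_singleton o).subset fun x hx => ?_
    exact (hV.connected.dist_eq_zero_iff.1 hx).symm
  | succ n ih =>
    refine (ih.biUnion fun u _ => hV.locallyFinite u).subset fun x hx => ?_
    obtain ⟨u, hu, h⟩ := exists_parent hV.connected hx
    exact Set.mem_biUnion hu (mem_descendants_one_iff.1 h).1

theorem finite_setOf_level_le (hV : IsRooted V) (n : ℕ) : {x | level V o x ≤ n}.Finite := by
  refine ((Set.finite_le_nat n).biUnion fun m _ =>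
    finite_setOf_level_eq (o := o) hV m).subset fun x hx => ?_
  exact Set.mem_biUnion (show level V o x ∈ {m | m ≤ n} from hx) rfl

theorem Ray.isAncestor (r : Ray V o) {m n : ℕ} (h : m ≤ n) :
    IsAncestor V o (r.vertex m) (r.vertex n) := by
  induction n, h using Nat.le_induction with
  | base => exact Relation.ReflTransGen.refl
  | succ n _ ih => exact ih.tail (r.vertex_succ n)

/-- **König's lemma**, in terms of ultrafilters: the vertices `u` whose sets of descendants are
large for an ultrafilter tending to infinity form a ray. -/
theorem exists_ray_of_ultrafilter (hV : IsRooted V) (𝓤 : Ultrafilter X)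
    (h𝓤 : Tendsto (level V o) 𝓤 atTop) :
    ∃ r : Ray V o, ∀ n, ∀ᶠ x in (𝓤 : Filter X), IsAncestor V o (r.vertex n) x := by
  have key : ∀ u, (∀ᶠ x in (𝓤 : Filter X), IsAncestor V o u x) →
      ∃ v, v ∈ descendants V o 1 u ∧ ∀ᶠ x in (𝓤 : Filter X), IsAncestor V o v x := by
    intro u hu
    have hfin : (descendants V o 1 u).Finite :=
      (hV.locallyFinite u).subset fun v hv => (mem_descendants_one_iff.1 hv).1
    have hmem : (⋃ v ∈ descendants V o 1 u, {x | IsAncestor V o v x}) ∈ 𝓤 := by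
      filter_upwards [hu, h𝓤.eventually_gt_atTop (level V o u)] with x hx hlx
      rcases Relation.ReflTransGen.cases_head hx with rfl | ⟨v, hv, hvx⟩
      · exact absurd hlx (lt_irrefl _)
      · exact Set.mem_biUnion hv hvx
    obtain ⟨v, hv, h⟩ := (Ultrafilter.finite_biUnion_mem_iff hfin).1 hmem
    exact ⟨v, hv, h⟩
  choose! f hf1 hf2 using key
  have hall : ∀ n, ∀ᶠ x in (𝓤 : Filter X), IsAncestor V o (f^[n] o) x := by
    intro n
    induction n with
    | zero => exact Eventually.of_forall (isAncestor_root hV.connected)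
    | succ n ih => rw [Function.iterate_succ_apply']; exact hf2 _ ih
  exact ⟨⟨fun n => f^[n] o, rfl, fun n => by
    rw [Function.iterate_succ_apply']; exact hf1 _ (hall n)⟩, hall⟩

end VerticalGraphs

/-! ### Index maps and their attractors -/

section IndexMaps

variable {X M : Type*} [MetricSpace M] {V : SimpleGraph X} {o : X}
  {Φ : X → TopologicalSpace.NonemptyCompacts M}

theorem IsAncestor.image_subset (hΦ : IsIndexMap V o Φ) {u x : X} (h : IsAncestor V o u x) :
    (Φ x : Set M) ⊆ Φ u := by
  induction h with
  | refl => exact le_rfl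
  | tail _ h ih => exact (hΦ.subset _ _ h).trans ih

theorem IsAncestor.image_inter_nonempty (hΦ : IsIndexMap V o Φ) {u v x y : X}
    (hu : IsAncestor V o u x) (hv : IsAncestor V o v y)
    (h : ((Φ x : Set M) ∩ Φ y).Nonempty) : ((Φ u : Set M) ∩ Φ v).Nonempty :=
  h.mono (Set.inter_subset_inter (hu.image_subset hΦ) (hv.image_subset hΦ))

theorem inter_self_nonempty (x : X) : ((Φ x : Set M) ∩ Φ x).Nonempty := by
  rw [Set.inter_self]; exact (Φ x).nonempty

theorem mem_kappaZero (hΦ : IsIndexMap V o Φ) (r : Ray V o) (n : ℕ) :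
    (kappaZero hΦ r : M) ∈ (Φ (r.vertex n) : Set M) :=
  Set.mem_iInter.1 ((hΦ.singleton r).choose_spec.ge rfl) n

theorem eq_kappaZero (hΦ : IsIndexMap V o Φ) (r : Ray V o) {p : M}
    (h : ∀ n, p ∈ (Φ (r.vertex n) : Set M)) : p = kappaZero hΦ r := by
  have h1 : p ∈ ⋂ i, (Φ (r.vertex i) : Set M) := Set.mem_iInter.2 h
  rwa [(hΦ.singleton r).choose_spec] at h1

/-- Going down from `x` from child to child gives nested compact sets, whose common points lie in
the attractor since every level is reached through ancestors. -/
theorem cell_nonempty (hV : IsVertical V o) (hΦ : IsIndexMap V o Φ) (x : X) :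
    (cell V o Φ x).Nonempty := by
  choose c hc using hV.child
  have hlev : ∀ n, level V o (c^[n] x) = level V o x + n := by
    intro n
    induction n with
    | zero => rfl
    | succ n ih => rw [Function.iterate_succ_apply', (hc _).2, ih]; rfl
  obtain ⟨p, hp⟩ := IsCompact.nonempty_iInter_of_sequence_nonempty_isCompact_isClosed
    (fun n => (Φ (c^[n] x) : Set M))
    (fun n => by rw [Function.iterate_succ_apply']; exact hΦ.subset _ _ (hc _))
    (fun n => (Φ _).nonempty) (Φ _).isCompact (fun n => (Φ _).isCompact.isClosed)
  rw [Set.mem_iInter] at hp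
  refine ⟨p, hp 0, Set.mem_iInter.2 fun n => ?_⟩
  obtain ⟨u, hu, hanc⟩ := exists_ancestor hV.rooted.connected (n := n) (x := c^[n] x) (o := o)
    (by rw [hlev]; omega)
  exact Set.mem_biUnion (x := u) hu (hanc.image_subset hΦ (hp n))

/-- Every point of the attractor is the image of a ray. -/
theorem kappaZero_surjective (hV : IsVertical V o) (hΦ : IsIndexMap V o Φ) :
    Function.Surjective (kappaZero hΦ) := by
  rintro ⟨p, hp⟩
  have hp' : ∀ n, ∃ x, level V o x = n ∧ p ∈ (Φ x : Set M) := fun n => by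
    simpa using Set.mem_iInter.1 hp n
  choose x hx hpx using hp'
  let 𝓤 : Ultrafilter X := Ultrafilter.of (map x atTop)
  have hle : (𝓤 : Filter X) ≤ map x atTop := Ultrafilter.of_le _
  have h1 : Tendsto (level V o) 𝓤 atTop := by
    refine Tendsto.mono_left (tendsto_map'_iff.2 ?_) hle
    rw [show level V o ∘ x = id from funext hx]
    exact tendsto_id
  have h2 : ∀ᶠ y in (𝓤 : Filter X), p ∈ (Φ y : Set M) :=
    hle (Eventually.of_forall (f := atTop) hpx)
  obtain ⟨r, hr⟩ := exists_ray_of_ultrafilter hV.rooted 𝓤 h1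
  refine ⟨r, Subtype.ext (eq_kappaZero hΦ r fun n => ?_).symm⟩
  obtain ⟨y, hy, hpy⟩ := ((hr n).and h2).exists
  exact hy.image_subset hΦ hpy

/-! ### The intersection graph -/

theorem le_intersectionGraph : V ≤ intersectionGraph V o Φ := fun _ _ h => Or.inl h

theorem connected_intersectionGraph (hV : IsRooted V) : (intersectionGraph V o Φ).Connected :=
  hV.connected.mono le_intersectionGraph

theorem IsVertical.level_of_adj (hV : IsVertical V o) {x y : X} (h : V.Adj x y) :
    level V o x = level V o y + 1 ∨ level V o y = level V o x + 1 := by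
  rw [← hV.vertical] at h
  exact h.2

theorem level_le_of_adj (hV : IsVertical V o) {x y : X} (h : (intersectionGraph V o Φ).Adj x y) :
    level V o x ≤ level V o y + 1 := by
  rcases h with h | h
  · have := hV.level_of_adj h; omega
  · have := h.1; omega

theorem level_intersectionGraph (hV : IsVertical V o) (x : X) :
    level (intersectionGraph V o Φ) o x = level V o x := by
  refine le_antisymm (SimpleGraph.Reachable.dist_anti le_intersectionGraph
    (hV.rooted.connected _ _)) ?_
  obtain ⟨p, hp⟩ := (connected_intersectionGraph (o := o) (Φ := Φ) hV.rooted).exists_walk_length_eq_dist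
    (u := x) (v := o)
  rw [level, level, (intersectionGraph V o Φ).dist_comm, ← hp]
  have key : ∀ {x y : X} (p : (intersectionGraph V o Φ).Walk x y),
      level V o x ≤ level V o y + p.length := by
    intro x y p
    induction p with
    | nil => simp
    | cons h q ih =>
      have := level_le_of_adj hV h
      rw [SimpleGraph.Walk.length_cons]
      omega
  simpa [level] using key p

theorem image_inter_nonempty_of_adj (hV : IsVertical V o) (hΦ : IsIndexMap V o Φ) {x y : X}
    (h : (intersectionGraph V o Φ).Adj x y) : ((Φ x : Set M) ∩ Φ y).Nonempty := by
  rcases h with h | h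
  · rcases hV.level_of_adj h with hl | hl
    · have := hΦ.subset _ _ (mem_descendants_one_iff.2 ⟨h.symm, hl⟩)
      rw [Set.inter_eq_left.2 this]
      exact (Φ x).nonempty
    · have := hΦ.subset _ _ (mem_descendants_one_iff.2 ⟨h, hl⟩)
      rw [Set.inter_eq_right.2 this]
      exact (Φ y).nonempty
  · exact h.2.2

theorem dist_le_one_of_inter_nonempty {x y : X} (hl : level V o x = level V o y)
    (h : ((Φ x : Set M) ∩ Φ y).Nonempty) : (intersectionGraph V o Φ).dist x y ≤ 1 := by
  by_cases hxy : x = y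
  · simp [hxy]
  · exact (SimpleGraph.dist_eq_one_iff_adj.2 (Or.inr ⟨hl, hxy, h⟩)).le

theorem isRooted_intersectionGraph (hV : IsVertical V o) :
    IsRooted (intersectionGraph V o Φ) where
  connected := connected_intersectionGraph hV.rooted
  locallyFinite x := (finite_setOf_level_le hV.rooted (level V o x + 1)).subset fun _ hy =>
    level_le_of_adj (Φ := Φ) hV (SimpleGraph.Adj.symm hy)

theorem verticalPart_intersectionGraph (hV : IsVertical V o) :
    verticalPart (intersectionGraph V o Φ) o = V := by
  ext x y
  simp only [verticalPart, level_intersectionGraph hV]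
  constructor
  · rintro ⟨h | h, h'⟩
    · exact h
    · have := h.1; omega
  · exact fun h => ⟨Or.inl h, hV.level_of_adj h⟩

theorem descendants_intersectionGraph (hV : IsVertical V o) (x : X) :
    descendants (intersectionGraph V o Φ) o 1 x = descendants V o 1 x := by
  ext y
  simp only [mem_descendants_one_iff, level_intersectionGraph hV]
  refine and_congr_left fun hl => ⟨?_, Or.inl⟩
  rintro (h | h)
  · exact h
  · have := h.1; omega

theorem isExpansive_intersectionGraph (hV : IsVertical V o) (hΦ : IsIndexMap V o Φ) :
    IsExpansive (intersectionGraph V o Φ) o where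
  rooted := isRooted_intersectionGraph hV
  expansive x y hxy u hu v hv := by
    have hiff : ∀ x y, horizontalDist (intersectionGraph V o Φ) o x y ≤ 1 ↔
        level V o x = level V o y ∧ ((Φ x : Set M) ∩ Φ y).Nonempty := by
      intro x y
      rw [horizontalDist, SimpleGraph.edist_le_one_iff_adj_or_eq]
      simp only [horizontalPart, level_intersectionGraph hV]
      constructor
      · rintro (h | rfl)
        · exact ⟨h.2, image_inter_nonempty_of_adj hV hΦ h.1⟩
        · exact ⟨rfl, inter_self_nonempty x⟩
      · intro h
        by_cases hxy : x = y
        · exact Or.inr hxy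
        · exact Or.inl ⟨Or.inr ⟨h.1, hxy, h.2⟩, h.1⟩
    rw [descendants_intersectionGraph hV] at hu hv
    rw [← not_le, hiff] at hxy ⊢
    refine fun h => hxy ⟨?_, h.2.mono
      (Set.inter_subset_inter (hΦ.subset _ _ hu) (hΦ.subset _ _ hv))⟩
    have := hu.2
    have := hv.2
    have := h.1
    omega

end IndexMaps

/-! ### Diameters along geodesics -/

/-- Along a geodesic of length `d` between points of levels `α` and `β`, the levels are bounded
below by `α - i` and by `β - (d - i)`. Both bounds together give a two-sided geometric series
around the turning point, where the level is about the Gromov product `(α + β - d) / 2`. -/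
theorem sum_exp_le {b : ℝ} (hb : 0 < b) {α β : ℝ} {d : ℕ} {l : ℕ → ℝ}
    (h1 : ∀ i ≤ d, α - i ≤ l i) (h2 : ∀ i ≤ d, β - (d - i) ≤ l i) (hαβ : β ≤ α + d)
    (hβα : α ≤ β + d) :
    ∑ i ∈ Finset.range (d + 1), Real.exp (-b * l i) ≤
      (1 + Real.exp b) * (1 - Real.exp (-b))⁻¹ * Real.exp (-b * ((α + β - d) / 2)) := by
  set g := (α + β - d) / 2 with hg
  have hr1 : Real.exp (-b) < 1 := by rw [Real.exp_lt_one_iff]; linarith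
  have hgeom : ∀ m : ℕ, ∑ j ∈ Finset.range m, Real.exp (-b * j) ≤ (1 - Real.exp (-b))⁻¹ := by
    intro m
    rw [← tsum_geometric_of_lt_one (Real.exp_pos _).le hr1]
    refine le_trans (le_of_eq (Finset.sum_congr rfl fun j _ => ?_))
      ((summable_geometric_of_lt_one (Real.exp_pos _).le hr1).sum_le_tsum (Finset.range m)
        fun _ _ => by positivity)
    rw [← Real.exp_nat_mul, mul_comm]
  set k := ⌊α - g⌋₊ with hk
  have hk1 : (k : ℝ) ≤ α - g := Nat.floor_le (by rw [hg]; linarith)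
  have hk2 : α - g < k + 1 := Nat.lt_floor_add_one _
  have hkd : k ≤ d := by
    have : (k : ℝ) ≤ d := by rw [hg] at hk1; linarith
    exact_mod_cast this
  have hsplit : d + 1 = k + (d + 1 - k) := by omega
  rw [hsplit, Finset.sum_range_add, add_mul, add_mul, one_mul]
  refine add_le_add ?_ ?_
  · rw [← Finset.sum_range_reflect]
    calc _ ≤ ∑ j ∈ Finset.range k, Real.exp (-b * j) * Real.exp (-b * g) := by
          refine Finset.sum_le_sum fun j hj => ?_
          have hj' := Finset.mem_range.1 hj
          rw [← Real.exp_add, ← mul_add]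
          refine Real.exp_le_exp.2 (mul_le_mul_of_nonpos_left ?_ (by linarith))
          refine le_trans ?_ (h1 (k - 1 - j) (by omega))
          rw [Nat.cast_sub (by omega), Nat.cast_sub (by omega)]
          push_cast
          linarith
      _ ≤ _ := by
          rw [← Finset.sum_mul]
          exact mul_le_mul_of_nonneg_right (hgeom _) (Real.exp_pos _).le
  · calc _ ≤ ∑ j ∈ Finset.range (d + 1 - k),
            Real.exp b * Real.exp (-b * j) * Real.exp (-b * g) := by
          refine Finset.sum_le_sum fun j hj => ?_
          have hj' := Finset.mem_range.1 hj
          rw [← Real.exp_add, ← Real.exp_add]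
          have h := h2 (k + j) (by omega)
          push_cast at h
          have h3 : g - 1 + j ≤ l (k + j) := by rw [hg] at *; linarith
          exact Real.exp_le_exp.2 (by nlinarith)
      _ ≤ _ := by
          rw [← Finset.sum_mul, ← Finset.mul_sum]
          exact mul_le_mul_of_nonneg_right
            (mul_le_mul_of_nonneg_left (hgeom _) (Real.exp_pos _).le) (Real.exp_pos _).le

section IndexMaps

variable {X M : Type*} [MetricSpace M] {V : SimpleGraph X} {o : X}
  {Φ : X → TopologicalSpace.NonemptyCompacts M}

theorem IsExponentialType.exists_bound (hV : IsRooted V) {b : ℝ}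
    (h : IsExponentialType V o Φ b) :
    ∃ C : ℝ, 0 < C ∧ ∀ x, Metric.diam (Φ x : Set M) ≤ C * Real.exp (-b * level V o x) := by
  obtain ⟨C, hC⟩ := h.bound
  rw [eventually_comap] at hC
  obtain ⟨n, hn⟩ := eventually_atTop.1 hC
  obtain ⟨D, hD⟩ := ((finite_setOf_level_le (o := o) hV n).image fun x =>
    Metric.diam (Φ x : Set M) / Real.exp (-b * level V o x)).bddAbove
  refine ⟨max 1 (max C D), by positivity, fun x => ?_⟩
  rw [← div_le_iff₀ (Real.exp_pos _)]
  rcases le_total (level V o x) n with hx | hx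
  · exact (hD (Set.mem_image_of_mem _ hx)).trans ((le_max_right _ _).trans (le_max_right _ _))
  · have := hn _ hx x rfl
    rw [Real.norm_of_nonneg Metric.diam_nonneg, Real.norm_of_nonneg (Real.exp_pos _).le,
      ← div_le_iff₀ (Real.exp_pos _)] at this
    exact this.trans ((le_max_left _ _).trans (le_max_right _ _))

theorem dist_le_sum_diam (hV : IsVertical V o) (hΦ : IsIndexMap V o Φ) {x y : X}
    (p : (intersectionGraph V o Φ).Walk x y) {z : X} (hz : z ∈ p.support) {ξ η : M}
    (hξ : ξ ∈ (Φ x : Set M)) (hη : η ∈ (Φ z : Set M)) :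
    dist ξ η ≤ ∑ i ∈ Finset.range (p.length + 1), Metric.diam (Φ (p.getVert i) : Set M) := by
  induction p generalizing ξ with
  | nil =>
    rw [SimpleGraph.Walk.support_nil, List.mem_singleton] at hz
    subst hz
    simpa using Metric.dist_le_diam_of_mem (Φ z).isCompact.isBounded hξ hη
  | @cons x x' _ h q ih =>
    rw [SimpleGraph.Walk.length_cons, Finset.sum_range_succ']
    simp only [SimpleGraph.Walk.getVert_cons_succ, SimpleGraph.Walk.getVert_zero]
    rw [SimpleGraph.Walk.support_cons, List.mem_cons] at hz
    rcases hz with rfl | hz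
    · have h1 := Metric.dist_le_diam_of_mem (Φ z).isCompact.isBounded hξ hη
      have h2 : 0 ≤ ∑ i ∈ Finset.range (q.length + 1), Metric.diam (Φ (q.getVert i) : Set M) :=
        Finset.sum_nonneg fun _ _ => Metric.diam_nonneg
      linarith
    · obtain ⟨ζ, hζ, hζ'⟩ := image_inter_nonempty_of_adj hV hΦ h
      have h1 := Metric.dist_le_diam_of_mem (Φ x).isCompact.isBounded hξ hζ
      have h2 := ih hz hζ'
      linarith [dist_triangle ξ ζ η]

theorem level_le_getVert_add {G : SimpleGraph X} (hG : G.Connected) {x y : X} (p : G.Walk x y)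
    (i : ℕ) : level G o x ≤ level G o (p.getVert i) + i := by
  refine (level_le_add_dist hG x (p.getVert i)).trans (Nat.add_le_add_left ?_ _)
  refine (G.dist_le (p.take i)).trans ?_
  simp

theorem level_le_getVert_add_sub {G : SimpleGraph X} (hG : G.Connected) {x y : X}
    (p : G.Walk x y) (i : ℕ) : level G o y ≤ level G o (p.getVert i) + (p.length - i) := by
  refine (level_le_add_dist hG y (p.getVert i)).trans (Nat.add_le_add_left ?_ _)
  rw [G.dist_comm]
  refine (G.dist_le (p.drop i)).trans ?_
  simp

/-- A geodesic stays at levels at least the Gromov product of its endpoints. -/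
theorem gromovProduct_le_level {G : SimpleGraph X} (hG : G.Connected) {x y : X} (p : G.Walk x y)
    (hp : p.length = G.dist x y) {z : X} (hz : z ∈ p.support) :
    gromovProduct G o x y ≤ level G o z := by
  obtain ⟨i, rfl, hi⟩ := SimpleGraph.Walk.mem_support_iff_exists_getVert.1 hz
  have h1 := level_le_getVert_add (o := o) hG p i
  have h2 := level_le_getVert_add_sub (o := o) hG p i
  have h3 : level G o x + level G o y ≤ 2 * level G o (p.getVert i) + G.dist x y := by omega
  have h4 : (level G o x : ℝ) + level G o y ≤ 2 * level G o (p.getVert i) + G.dist x y := by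
    exact_mod_cast h3
  rw [gromovProduct]
  linarith

/-- The union of the sets `Φ z` over the vertices `z` of a geodesic from `x` to `y` has diameter
`O(e ^ (-b (x|y)))`. -/
theorem exists_dist_le_of_mem_geodesic (hV : IsVertical V o) (hΦ : IsIndexMap V o Φ) {b : ℝ}
    (hb : 0 < b) (hexp : IsExponentialType V o Φ b) :
    ∃ C : ℝ, 0 < C ∧ ∀ (x y : X) (p : (intersectionGraph V o Φ).Walk x y),
      p.length = (intersectionGraph V o Φ).dist x y → ∀ z ∈ p.support, ∀ w ∈ p.support,
        ∀ ξ ∈ (Φ z : Set M), ∀ η ∈ (Φ w : Set M),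
          dist ξ η ≤ C * Real.exp (-b * gromovProduct (intersectionGraph V o Φ) o x y) := by
  obtain ⟨C, hC, hdiam⟩ := hexp.exists_bound hV.rooted
  have hr1 : 0 < 1 - Real.exp (-b) := by
    rw [sub_pos, Real.exp_lt_one_iff]; linarith
  have hG := connected_intersectionGraph (o := o) (Φ := Φ) hV.rooted
  refine ⟨2 * (C * ((1 + Real.exp b) * (1 - Real.exp (-b))⁻¹)), by positivity, ?_⟩
  intro x y p hp z hz w hw ξ hξ η hη
  have hsum : ∑ i ∈ Finset.range (p.length + 1), Metric.diam (Φ (p.getVert i) : Set M) ≤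
      C * ((1 + Real.exp b) * (1 - Real.exp (-b))⁻¹) *
        Real.exp (-b * gromovProduct (intersectionGraph V o Φ) o x y) := by
    have h3 := hG.dist_triangle (u := o) (v := x) (w := y)
    have h4 := level_le_add_dist (o := o) hG x y
    have h := sum_exp_le hb (d := p.length) (α := level (intersectionGraph V o Φ) o x)
      (β := level (intersectionGraph V o Φ) o y)
      (l := fun i => level (intersectionGraph V o Φ) o (p.getVert i))
      (fun i hi => by
        have := level_le_getVert_add (o := o) hG p i
        rw [sub_le_iff_le_add]
        exact_mod_cast this)
      (fun i hi => by
        have := level_le_getVert_add_sub (o := o) hG p i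
        rw [sub_le_iff_le_add, ← Nat.cast_sub hi]
        exact_mod_cast this)
      (by rw [hp]; exact_mod_cast h3) (by rw [hp]; exact_mod_cast h4)
    rw [hp] at h ⊢
    rw [mul_assoc]
    refine le_trans ?_ (mul_le_mul_of_nonneg_left h hC.le)
    rw [Finset.mul_sum]
    refine Finset.sum_le_sum fun i _ => ?_
    rw [level_intersectionGraph hV]
    exact hdiam _
  obtain ⟨ζ, hζ⟩ := (Φ x).nonempty
  have h1 := (dist_le_sum_diam hV hΦ p hz hζ hξ).trans hsum
  have h2 := (dist_le_sum_diam hV hΦ p hw hζ hη).trans hsum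
  have h3 := dist_triangle_left ξ η ζ
  linarith

/-- Points of `Φ x` and of `Φ y` are at distance `O(e ^ (-b (x|y)))`. -/
theorem exists_dist_le_exp_gromovProduct (hV : IsVertical V o) (hΦ : IsIndexMap V o Φ) {b : ℝ}
    (hb : 0 < b) (hexp : IsExponentialType V o Φ b) :
    ∃ C : ℝ, 0 < C ∧ ∀ x y, ∀ ξ ∈ (Φ x : Set M), ∀ η ∈ (Φ y : Set M),
      dist ξ η ≤ C * Real.exp (-b * gromovProduct (intersectionGraph V o Φ) o x y) := by
  obtain ⟨C, hC, h⟩ := exists_dist_le_of_mem_geodesic hV hΦ hb hexp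
  refine ⟨C, hC, fun x y => ?_⟩
  obtain ⟨p, hp⟩ := (connected_intersectionGraph (o := o) (Φ := Φ)
    hV.rooted).exists_walk_length_eq_dist x y
  exact h x y p hp x p.start_mem_support y p.end_mem_support

/-! ### Bounding families of disjoint cells -/

/-- For every `c > 0`, the families of vertices of level `n` whose images under `Φ` are pairwise
disjoint and whose cells meet a given set of diameter at most `c * e ^ (-b n)` have bounded
cardinality. This is what the conditions `(S_b)` and `(B_b)` have in common. -/
def HasDisjointCellBound (V : SimpleGraph X) (o : X)
    (Φ : X → TopologicalSpace.NonemptyCompacts M) (b : ℝ) : Prop :=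
  ∀ c : ℝ, 0 < c → ∃ N : ℕ, ∀ (n : ℕ) (F : Set M) (S : Finset X),
    (∀ p ∈ F, ∀ q ∈ F, dist p q ≤ c * Real.exp (-b * n)) →
    (∀ x ∈ S, level V o x = n ∧ (cell V o Φ x ∩ F).Nonempty) →
    (∀ x ∈ S, ∀ y ∈ S, ((Φ x : Set M) ∩ Φ y).Nonempty → x = y) → S.card ≤ N

theorem ConditionS.hasDisjointCellBound {b : ℝ} (h : ConditionS V o Φ b) :
    HasDisjointCellBound V o Φ b := by
  intro c hc
  obtain ⟨N, hN⟩ := h (2 * c) (by positivity)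
  refine ⟨N, fun n F S hF hS _ => ?_⟩
  have hdiam : Metric.ediam F < ENNReal.ofReal (2 * c * Real.exp (-b * n)) := by
    refine lt_of_le_of_lt (Metric.ediam_le (d := ENNReal.ofReal (c * Real.exp (-b * n)))
      fun p hp q hq => ?_) ?_
    · rw [edist_dist]
      exact ENNReal.ofReal_le_ofReal (hF p hp q hq)
    · rw [ENNReal.ofReal_lt_ofReal_iff (by positivity)]
      have : 0 < c * Real.exp (-b * n) := by positivity
      linarith
  have := (Set.encard_le_encard (s := (S : Set X)) hS).trans (hN n F hdiam)
  rw [Set.encard_coe_eq_coe_finsetCard] at this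
  exact_mod_cast this

/-- In a doubling space a ball is covered by boundedly many balls of radius smaller by the factor
`2 ^ k`. -/
theorem IsDoubling.exists_cover {α : Type*} [MetricSpace α] (h : IsDoubling α) (k : ℕ) :
    ∃ N : ℕ, ∀ (ξ : α) (r : ℝ), 0 < r → ∃ s : Finset α, s.card ≤ N ∧
      Metric.ball ξ r ⊆ ⋃ η ∈ s, Metric.ball η (r / 2 ^ k) := by
  classical
  obtain ⟨N, hN⟩ := h
  induction k with
  | zero => exact ⟨1, fun ξ r _ => ⟨{ξ}, by simp, by simp⟩⟩
  | succ k ih =>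
    obtain ⟨N', hN'⟩ := ih
    refine ⟨N' * N, fun ξ r hr => ?_⟩
    obtain ⟨s, hs, hcov⟩ := hN' ξ r hr
    choose t ht htcov using fun η => hN η (r / 2 ^ k) (by positivity)
    refine ⟨s.biUnion t, (Finset.card_biUnion_le_card_mul _ _ _ fun η _ => ht η).trans
      (Nat.mul_le_mul_right _ hs), fun p hp => ?_⟩
    obtain ⟨η, hη, hpη⟩ := Set.mem_iUnion₂.1 (hcov hp)
    obtain ⟨ζ, hζ, hpζ⟩ := Set.mem_iUnion₂.1 (htcov η hpη)
    refine Set.mem_iUnion₂.2 ⟨ζ, Finset.mem_biUnion.2 ⟨η, hη, hζ⟩, ?_⟩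
    rwa [pow_succ, ← div_div]

theorem ConditionB.hasDisjointCellBound (hV : IsRooted V) {b : ℝ}
    (hexp : IsExponentialType V o Φ b) (hdoub : IsDoubling (attractor V o Φ))
    (h : ConditionB V o Φ b) : HasDisjointCellBound V o Φ b := by
  classical
  obtain ⟨ι, hι, c₀, hc₀, hball⟩ := h
  obtain ⟨C, hC, hdiam⟩ := hexp.exists_bound hV
  intro c hc
  -- The centers `ι x` lie in a ball of radius `R * e ^ (-b n)`, which is covered by balls of
  -- radius at most `c₀ * e ^ (-b n) / 2`.
  set R := c + 2 * C + 1 with hR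
  have hRpos : 0 < R := by positivity
  obtain ⟨k, hk⟩ := pow_unbounded_of_one_lt (2 * R / c₀) (one_lt_two (α := ℝ))
  obtain ⟨N, hN⟩ := hdoub.exists_cover k
  refine ⟨N, fun n F S hF hS hdisj => ?_⟩
  rcases S.eq_empty_or_nonempty with rfl | ⟨x₀, hx₀⟩
  · simp
  set e := Real.exp (-b * n) with he
  have hepos : 0 < e := Real.exp_pos _
  let j : X → attractor V o Φ := fun x => ⟨ι x, (hι x).2⟩
  obtain ⟨s, hs, hcov⟩ := hN (j x₀) (R * e) (by positivity)
  have hmem : ∀ x ∈ S, j x ∈ Metric.ball (j x₀) (R * e) := by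
    intro x hx
    obtain ⟨hl, p, hp, hpF⟩ := hS x hx
    obtain ⟨hl₀, p₀, hp₀, hpF₀⟩ := hS x₀ hx₀
    have h1 := (Metric.dist_le_diam_of_mem (Φ x).isCompact.isBounded (hι x).1 hp.1).trans
      (hdiam x)
    have h2 := (Metric.dist_le_diam_of_mem (Φ x₀).isCompact.isBounded hp₀.1 (hι x₀).1).trans
      (hdiam x₀)
    rw [hl] at h1
    rw [hl₀] at h2
    have h3 := hF p hpF p₀ hpF₀
    have h4 := dist_triangle4 (ι x) p p₀ (ι x₀)
    rw [Metric.mem_ball]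
    change dist (ι x) (ι x₀) < R * e
    have h5 : R * e = c * e + 2 * (C * e) + e := by rw [hR]; ring
    linarith
  have hex : ∀ x ∈ S, ∃ η ∈ s, dist (j x) η < R * e / 2 ^ k := fun x hx => by
    simpa using hcov (hmem x hx)
  have : Nonempty (attractor V o Φ) := ⟨j x₀⟩
  choose! f hfs hf using hex
  refine (Finset.card_le_card_of_injOn f hfs fun x hx y hy hxy => ?_).trans hs
  refine hdisj x hx y hy ?_
  have h1 := hf x hx
  have h2 := hf y hy
  rw [← hxy] at h2
  have h3 : dist (ι y) (ι x) < c₀ * e := by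
    have h4 : R * e / 2 ^ k ≤ c₀ * e / 2 := by
      rw [div_lt_iff₀ hc₀] at hk
      rw [div_le_iff₀ (by positivity)]
      nlinarith
    have h5 : dist (j y) (j x) < c₀ * e := by
      have := dist_triangle_right (j y) (j x) (f x)
      linarith
    exact h5
  have h6 : ι y ∈ cell V o Φ x := hball x ⟨by
    rw [Metric.mem_ball, (hS x hx).1]; exact h3, (hι y).2⟩
  exact ⟨ι y, h6.1, (hι y).1⟩

end IndexMaps

/-! ### Hyperbolicity -/

section IndexMaps

variable {X M : Type*} [MetricSpace M] {V : SimpleGraph X} {o : X}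
  {Φ : X → TopologicalSpace.NonemptyCompacts M}

/-- A bound on independent sets bounds distances, since the vertices of even index on a geodesic
are pairwise distinct and nonadjacent. -/
theorem dist_le_two_mul_of_card_le {H : SimpleGraph X} {u v : X} (h : H.Reachable u v) {N : ℕ}
    (hN : ∀ S : Finset X, (∀ x ∈ S, H.Reachable u x) →
      (∀ x ∈ S, ∀ y ∈ S, x = y ∨ ¬ H.Adj x y) → S.card ≤ N) : H.dist u v ≤ 2 * N := by
  classical
  obtain ⟨p, hp⟩ := h.exists_walk_length_eq_dist
  have hreach : ∀ i, H.Reachable u (p.getVert i) := fun i => (p.take i).reachable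
  have hdist : ∀ i ≤ p.length, H.dist u (p.getVert i) = i := by
    intro i hi
    refine le_antisymm ((H.dist_le (p.take i)).trans (by simp)) ?_
    have h1 := (hreach i).dist_triangle_left v
    have h2 := H.dist_le (p.drop i)
    rw [SimpleGraph.Walk.drop_length] at h2
    omega
  have hcard := hN ((Finset.range (p.length / 2 + 1)).image fun i => p.getVert (2 * i)) ?_ ?_
  · rw [Finset.card_image_of_injOn, Finset.card_range] at hcard
    · omega
    · intro i hi j hj hij
      have hi' := Finset.mem_range.1 hi
      have hj' := Finset.mem_range.1 hj
      have h1 := hdist (2 * i) (by omega)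
      have h2 := hdist (2 * j) (by omega)
      simp only at hij
      rw [hij] at h1
      omega
  · intro x hx
    obtain ⟨i, -, rfl⟩ := Finset.mem_image.1 hx
    exact hreach _
  · intro x hx y hy
    obtain ⟨i, hi, rfl⟩ := Finset.mem_image.1 hx
    obtain ⟨j, hj, rfl⟩ := Finset.mem_image.1 hy
    have hi' := Finset.mem_range.1 hi
    have hj' := Finset.mem_range.1 hj
    rw [or_iff_not_imp_right, not_not]
    intro hadj
    have h1 := hdist (2 * i) (by omega)
    have h2 := hdist (2 * j) (by omega)
    have h3 := SimpleGraph.dist_eq_one_iff_adj.2 hadj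
    have h4 := (hreach (2 * i)).dist_triangle_left (p.getVert (2 * j))
    have h5 := (hreach (2 * j)).dist_triangle_left (p.getVert (2 * i))
    rw [H.dist_comm (u := p.getVert (2 * j))] at h5
    have : i = j := by omega
    rw [this]

/-- The ancestors at a fixed level `n` of the vertices of a walk that stays at levels at least `n`
induce a connected subgraph of the intersection graph. -/
theorem reachable_ancestors (hV : IsVertical V o) (hΦ : IsIndexMap V o Φ) {n : ℕ} {T : Set X}
    (hT : ∀ z ∈ T, n ≤ level V o z) {H : SimpleGraph X}
    (hH : ∀ u v x y, x ∈ T → y ∈ T → IsAncestor V o u x → IsAncestor V o v y →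
      level V o u = n → level V o v = n → (intersectionGraph V o Φ).Adj u v → H.Adj u v)
    {x y : X} (p : (intersectionGraph V o Φ).Walk x y) (hp : ∀ z ∈ p.support, z ∈ T) {u v : X}
    (hu : IsAncestor V o u x) (hun : level V o u = n) (hv : IsAncestor V o v y)
    (hvn : level V o v = n) : H.Reachable u v := by
  have link : ∀ u v x y, x ∈ T → y ∈ T → IsAncestor V o u x → IsAncestor V o v y →
      level V o u = n → level V o v = n → ((Φ x : Set M) ∩ Φ y).Nonempty →
      H.Reachable u v := by
    intro u v x y hx hy hu hv hun hvn hxy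
    by_cases huv : u = v
    · rw [huv]
    · exact (hH u v x y hx hy hu hv hun hvn (Or.inr ⟨hun.trans hvn.symm, huv,
        hu.image_inter_nonempty hΦ hv hxy⟩)).reachable
  induction p generalizing u with
  | nil =>
    have hx := hp _ (SimpleGraph.Walk.start_mem_support _)
    exact link _ _ _ _ hx hx hu hv hun hvn (inter_self_nonempty _)
  | @cons x x' _ h q ih =>
    have hx := hp _ (SimpleGraph.Walk.start_mem_support _)
    have hq : ∀ z ∈ q.support, z ∈ T := fun z hz => hp z (List.mem_cons_of_mem _ hz)
    have hx' := hq _ (SimpleGraph.Walk.start_mem_support _)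
    obtain ⟨u', hun', hu'⟩ := exists_ancestor hV.rooted.connected (hT _ hx')
    exact (link _ _ _ _ hx hx' hu hu' hun hun' (image_inter_nonempty_of_adj hV hΦ h)).trans
      (ih hq hu' hun' hv)

/-- The key estimate: up to the level of the Gromov product `(x|y)`, the ancestors of `x` and `y`
stay within bounded distance of each other. -/
theorem exists_dist_ancestors_le (hV : IsVertical V o) (hΦ : IsIndexMap V o Φ) {b : ℝ}
    (hb : 0 < b) (hexp : IsExponentialType V o Φ b) (hcell : HasDisjointCellBound V o Φ b) :
    ∃ N : ℕ, ∀ (x y : X) (n : ℕ), (n : ℝ) ≤ gromovProduct (intersectionGraph V o Φ) o x y →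
      ∀ u v, IsAncestor V o u x → IsAncestor V o v y → level V o u = n → level V o v = n →
        (intersectionGraph V o Φ).dist u v ≤ N := by
  obtain ⟨C, hC, hdiam⟩ := exists_dist_le_of_mem_geodesic hV hΦ hb hexp
  obtain ⟨N, hN⟩ := hcell C hC
  refine ⟨2 * N, fun x y n hn u v hu hv hun hvn => ?_⟩
  have hG := connected_intersectionGraph (o := o) (Φ := Φ) hV.rooted
  obtain ⟨p, hp⟩ := hG.exists_walk_length_eq_dist x y
  let T : Set X := {z | z ∈ p.support}
  have hT : ∀ z ∈ T, n ≤ level V o z := by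
    intro z hz
    have := hn.trans (gromovProduct_le_level hG p hp hz)
    rw [level_intersectionGraph hV] at this
    exact_mod_cast this
  let A : Set X := {w | level V o w = n ∧ ∃ z ∈ T, IsAncestor V o w z}
  let H : SimpleGraph X :=
    { Adj := fun w w' => (intersectionGraph V o Φ).Adj w w' ∧ w ∈ A ∧ w' ∈ A
      symm := ⟨fun _ _ h => ⟨h.1.symm, h.2.2, h.2.1⟩⟩
      loopless := ⟨fun _ h => h.1.ne rfl⟩ }
  have hreach : H.Reachable u v :=
    reachable_ancestors (H := H) hV hΦ hT (fun u v x y hx hy hu hv hun hvn h =>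
      ⟨h, ⟨hun, x, hx, hu⟩, ⟨hvn, y, hy, hv⟩⟩) p (fun _ hz => hz) hu hun hv hvn
  have huA : u ∈ A := ⟨hun, x, p.start_mem_support, hu⟩
  have hA : ∀ w, H.Reachable u w → w ∈ A := by
    have hwalk : ∀ {w w' : X}, H.Walk w w' → w ∈ A → w' ∈ A := by
      intro w w' q hw
      induction q with
      | nil => exact hw
      | cons h _ ih => exact ih h.2.2
    exact fun w ⟨q⟩ => hwalk q huA
  have hle : H ≤ intersectionGraph V o Φ := fun _ _ h => h.1
  refine (SimpleGraph.Reachable.dist_anti hle hreach).trans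
    (dist_le_two_mul_of_card_le hreach fun S hS hind => ?_)
  refine hN n (⋃ z ∈ T, cell V o Φ z) S ?_ ?_ ?_
  · intro ξ hξ η hη
    obtain ⟨z, hz, hξz⟩ := Set.mem_iUnion₂.1 hξ
    obtain ⟨w, hw, hηw⟩ := Set.mem_iUnion₂.1 hη
    refine (hdiam x y p hp z hz w hw ξ hξz.1 η hηw.1).trans ?_
    refine mul_le_mul_of_nonneg_left (Real.exp_le_exp.2 ?_) hC.le
    exact mul_le_mul_of_nonpos_left hn (by linarith)
  · intro w hw
    obtain ⟨hl, z, hz, hwz⟩ := hA w (hS w hw)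
    obtain ⟨ξ, hξ⟩ := cell_nonempty hV hΦ z
    exact ⟨hl, ξ, ⟨hwz.image_subset hΦ hξ.1, hξ.2⟩, Set.mem_biUnion hz hξ⟩
  · intro w hw w' hw' hint
    have hwA := hA w (hS w hw)
    have hwA' := hA w' (hS w' hw')
    by_contra hww
    exact (hind w hw w' hw').resolve_left hww
      ⟨Or.inr ⟨hwA.1.trans hwA'.1.symm, hww, hint⟩, hwA, hwA'⟩

theorem gromovProduct_nonneg {G : SimpleGraph X} (hG : G.Connected) (x y : X) :
    0 ≤ gromovProduct G o x y := by
  have h := hG.dist_triangle (u := x) (v := o) (w := y)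
  rw [G.dist_comm (u := x) (v := o)] at h
  change G.dist x y ≤ level G o x + level G o y at h
  have h' : (G.dist x y : ℝ) ≤ level G o x + level G o y := by exact_mod_cast h
  rw [gromovProduct]
  linarith

theorem gromovProduct_le_left {G : SimpleGraph X} (hG : G.Connected) (x y : X) :
    gromovProduct G o x y ≤ level G o x := by
  have h := level_le_add_dist (o := o) hG y x
  rw [G.dist_comm] at h
  have h' : (level G o y : ℝ) ≤ level G o x + G.dist x y := by exact_mod_cast h
  rw [gromovProduct]
  linarith

theorem gromovProduct_le_right {G : SimpleGraph X} (hG : G.Connected) (x y : X) :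
    gromovProduct G o x y ≤ level G o y := by
  rw [gromovProduct_comm]
  exact gromovProduct_le_left hG y x

/-- If `x` and `y` have ancestors of level `n` at distance at most `N`, then
`(x|y) ≥ n - N / 2`. -/
theorem le_gromovProduct_of_ancestors (hV : IsVertical V o) {x y u v : X} {n N : ℕ}
    (hu : IsAncestor V o u x) (hv : IsAncestor V o v y) (hun : level V o u = n)
    (hvn : level V o v = n) (h : (intersectionGraph V o Φ).dist u v ≤ N) :
    (n : ℝ) - N / 2 ≤ gromovProduct (intersectionGraph V o Φ) o x y := by
  have hG := connected_intersectionGraph (o := o) (Φ := Φ) hV.rooted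
  have h1 := hu.dist_add_level hG le_intersectionGraph
  have h2 := hv.dist_add_level hG le_intersectionGraph
  have h3 := hG.dist_triangle (u := x) (v := u) (w := y)
  have h4 := hG.dist_triangle (u := u) (v := v) (w := y)
  rw [(intersectionGraph V o Φ).dist_comm (u := x) (v := u)] at h3
  have h5 : (intersectionGraph V o Φ).dist x y + 2 * n ≤ level V o x + level V o y + N := by
    omega
  have h6 : ((intersectionGraph V o Φ).dist x y : ℝ) + 2 * n ≤
      level V o x + level V o y + N := by exact_mod_cast h5
  rw [gromovProduct, level_intersectionGraph hV, level_intersectionGraph hV]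
  linarith

theorem isHyperbolic_intersectionGraph (hV : IsVertical V o) (hΦ : IsIndexMap V o Φ) {b : ℝ}
    (hb : 0 < b) (hexp : IsExponentialType V o Φ b) (hcell : HasDisjointCellBound V o Φ b) :
    IsHyperbolic (intersectionGraph V o Φ) o := by
  obtain ⟨N, hN⟩ := exists_dist_ancestors_le hV hΦ hb hexp hcell
  have hG := connected_intersectionGraph (o := o) (Φ := Φ) hV.rooted
  -- Passing through an ancestor of `z` doubles `N`, which costs `N` in the Gromov product; rounding
  -- the product down to an integer level costs at most `1`.
  refine ⟨N + 1, by positivity, fun x y z => ?_⟩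
  set g := min (gromovProduct (intersectionGraph V o Φ) o x z)
    (gromovProduct (intersectionGraph V o Φ) o z y) with hg
  have hg0 : 0 ≤ g := le_min (gromovProduct_nonneg hG _ _) (gromovProduct_nonneg hG _ _)
  set n := ⌊g⌋₊ with hn
  have hng : (n : ℝ) ≤ g := Nat.floor_le hg0
  have hgn : g < n + 1 := Nat.lt_floor_add_one g
  have hxz : (n : ℝ) ≤ gromovProduct (intersectionGraph V o Φ) o x z :=
    hng.trans (min_le_left _ _)
  have hzy : (n : ℝ) ≤ gromovProduct (intersectionGraph V o Φ) o z y :=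
    hng.trans (min_le_right _ _)
  have hlev : ∀ w, (n : ℝ) ≤ level (intersectionGraph V o Φ) o w → n ≤ level V o w := by
    intro w hw
    rw [level_intersectionGraph hV] at hw
    exact_mod_cast hw
  obtain ⟨u, hun, hu⟩ := exists_ancestor hV.rooted.connected
    (hlev x (hxz.trans (gromovProduct_le_left hG _ _)))
  obtain ⟨v, hvn, hv⟩ := exists_ancestor hV.rooted.connected
    (hlev y (hzy.trans (gromovProduct_le_right hG _ _)))
  obtain ⟨w, hwn, hw⟩ := exists_ancestor hV.rooted.connected
    (hlev z (hxz.trans (gromovProduct_le_right hG _ _)))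
  have h1 := hN x z n hxz u w hu hw hun hwn
  have h2 := hN z y n hzy w v hw hv hwn hvn
  have h3 := hG.dist_triangle (u := u) (v := w) (w := v)
  have h4 := le_gromovProduct_of_ancestors (Φ := Φ) (N := 2 * N) hV hu hv hun hvn (by omega)
  push_cast at h4
  linarith

end IndexMaps

/-! ### The Gromov metric -/

section GromovMetric

variable {X : Type*} {G : SimpleGraph X} {o : X} {a : ℝ}

theorem gromovDist_le (x y : X) : gromovDist G o a x y ≤ Real.exp (-a * gromovProduct G o x y) := by
  by_cases h : x = y
  · rw [h, gromovDist_self]; positivity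
  · rw [gromovDist, if_neg h]
    exact csInf_le (chainSums_bddBelow G o a x y)
      ⟨1, fun i => if i = 0 then x else y, le_rfl, by simp, by simp, by simp⟩

/-- **Frink's lemma** for the Gromov metric: for an admissible parameter, `θ_a(x, y)` is
comparable to `e ^ (-a (x|y))` off the diagonal. -/
theorem IsGromovParameter.exp_le_two_mul_gromovDist (ha : IsGromovParameter G o a) {x y : X}
    (hxy : x ≠ y) : Real.exp (-a * gromovProduct G o x y) ≤ 2 * gromovDist G o a x y := by
  classical
  obtain ⟨ha0, δ, ⟨hδ0, hδ⟩, hlt⟩ := ha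
  have hsq : Real.exp (2 * (δ * a)) ≤ 2 := by
    rw [two_mul, Real.exp_add, ← Real.mul_self_sqrt (show (0 : ℝ) ≤ 2 by norm_num)]
    exact mul_le_mul hlt.le hlt.le (Real.exp_pos _).le (Real.sqrt_nonneg _)
  let E : X → X → ℝ := fun x y => Real.exp (-a * gromovProduct G o x y)
  -- The Gromov product with itself is finite, so `E` is corrected to vanish on the diagonal.
  let d : X → X → NNReal := fun x y => if x = y then 0 else (E x y).toNNReal
  have hd_self : ∀ x, d x x = 0 := fun x => if_pos rfl
  have hd_ne : ∀ x y, x ≠ y → (d x y : ℝ) = E x y := fun x y h => by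
    simp only [d, if_neg h]
    exact Real.coe_toNNReal _ (Real.exp_pos _).le
  have hdE : ∀ x y, (d x y : ℝ) ≤ E x y := by
    intro x y
    by_cases h : x = y
    · rw [h, hd_self]; exact (Real.exp_pos _).le
    · exact (hd_ne x y h).le
  have hd_comm : ∀ x y, d x y = d y x := fun x y => by
    by_cases h : x = y
    · rw [h]
    · simp only [d, if_neg h, if_neg (Ne.symm h), E, gromovProduct_comm G o x y]
  -- One use of hyperbolicity costs a factor `e ^ (δ a)`, two uses cost at most `2`.
  have hd2 : ∀ x y z, (d x y : ℝ) ≤ Real.exp (δ * a) * max (d x z : ℝ) (d z y) := by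
    intro x y z
    have h1 : (1 : ℝ) ≤ Real.exp (δ * a) := Real.one_le_exp (by positivity)
    by_cases hxz : x = z
    · subst hxz
      refine (le_max_right (d x x : ℝ) _).trans (le_mul_of_one_le_left ?_ h1)
      exact le_max_of_le_left (NNReal.coe_nonneg _)
    by_cases hzy : z = y
    · subst hzy
      refine (le_max_left _ (d z z : ℝ)).trans (le_mul_of_one_le_left ?_ h1)
      exact le_max_of_le_left (NNReal.coe_nonneg _)
    refine (hdE x y).trans ?_
    rw [hd_ne x z hxz, hd_ne z y hzy]
    have hmax : max (E x z) (E z y) =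
        Real.exp (-a * min (gromovProduct G o x z) (gromovProduct G o z y)) := by
      have hanti : Antitone fun t : ℝ => Real.exp (-a * t) := fun s t hst =>
        Real.exp_le_exp.2 (mul_le_mul_of_nonpos_left hst (by linarith))
      exact hanti.map_min.symm
    rw [hmax, ← Real.exp_add]
    refine Real.exp_le_exp.2 ?_
    nlinarith [hδ x y z]
  have hd3 : ∀ x₁ x₂ x₃ x₄, d x₁ x₄ ≤ 2 * max (d x₁ x₂) (max (d x₂ x₃) (d x₃ x₄)) := by
    intro x₁ x₂ x₃ x₄
    rw [← NNReal.coe_le_coe]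
    push_cast
    have h1 : (1 : ℝ) ≤ Real.exp (δ * a) := Real.one_le_exp (by positivity)
    have h2 := hd2 x₁ x₄ x₂
    have h3 := hd2 x₂ x₄ x₃
    set m := max (d x₁ x₂ : ℝ) (max (d x₂ x₃ : ℝ) (d x₃ x₄)) with hm
    have hm0 : 0 ≤ m := le_max_of_le_left (NNReal.coe_nonneg _)
    have h4 : max (d x₁ x₂ : ℝ) (d x₂ x₄) ≤ Real.exp (δ * a) * m := by
      refine max_le ((le_max_left _ _).trans (le_mul_of_one_le_left hm0 h1)) (h3.trans ?_)
      exact mul_le_mul_of_nonneg_left (le_max_right _ _) (Real.exp_pos _).le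
    calc (d x₁ x₄ : ℝ) ≤ Real.exp (δ * a) * (Real.exp (δ * a) * m) :=
          h2.trans (mul_le_mul_of_nonneg_left h4 (Real.exp_pos _).le)
      _ = Real.exp (2 * (δ * a)) * m := by rw [← mul_assoc, ← Real.exp_add, two_mul]
      _ ≤ 2 * m := mul_le_mul_of_nonneg_right hsq hm0
  let I : PseudoMetricSpace X := PseudoMetricSpace.ofPreNNDist d hd_self hd_comm
  have hlow : (d x y : ℝ) ≤ 2 * dist x y :=
    PseudoMetricSpace.le_two_mul_dist_ofPreNNDist d hd_self hd_comm hd3 x y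
  rw [hd_ne x y hxy] at hlow
  refine hlow.trans (mul_le_mul_of_nonneg_left ?_ zero_le_two)
  rw [gromovDist, if_neg hxy]
  refine le_csInf (chainSums_nonempty G o a x y) ?_
  rintro s ⟨n, c, -, rfl, rfl, rfl⟩
  exact (dist_le_range_sum_dist c n).trans (Finset.sum_le_sum fun i _ =>
    (PseudoMetricSpace.dist_ofPreNNDist_le d hd_self hd_comm _ _).trans (hdE _ _))

end GromovMetric

/-! ### The hyperbolic boundary -/

section Boundary

variable {X : Type*} {G : SimpleGraph X} {o : X} {a : ℝ}

theorem dist_toCompletion (x y : X) :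
    dist (toCompletion G o a x) (toCompletion G o a y) = gromovDist G o a x y :=
  UniformSpace.Completion.dist_eq _ _

/-- The vertices are isolated points of the completion. -/
theorem eventually_eq_of_tendsto_toCompletion (hG : G.Connected) (ha : IsGromovParameter G o a)
    {u : ℕ → X} {x : X}
    (h : Tendsto (fun i => toCompletion G o a (u i)) atTop (𝓝 (toCompletion G o a x))) :
    ∀ᶠ i in atTop, u i = x := by
  have hpos : 0 < Real.exp (-a * level G o x) / 2 := by positivity
  filter_upwards [(Metric.tendsto_nhds.1 h) _ hpos] with i hi
  by_contra hne
  rw [dist_toCompletion] at hi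
  have h1 := ha.exp_le_two_mul_gromovDist hne
  have h2 : Real.exp (-a * level G o x) ≤ Real.exp (-a * gromovProduct G o (u i) x) :=
    Real.exp_le_exp.2 (mul_le_mul_of_nonpos_left (gromovProduct_le_right hG _ _)
      (by linarith [ha.1]))
  linarith

theorem tendsto_exp_neg_mul_natCast (ha : 0 < a) :
    Tendsto (fun n : ℕ => Real.exp (-a * n)) atTop (𝓝 0) := by
  have h : Tendsto (fun n : ℕ => a * (n : ℝ)) atTop atTop :=
    tendsto_natCast_atTop_atTop.const_mul_atTop ha
  simpa only [neg_mul, Function.comp_def] using Real.tendsto_exp_neg_atTop_nhds_zero.comp h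

end Boundary

section IndexMaps

variable {X M : Type*} [MetricSpace M] {V : SimpleGraph X} {o : X}
  {Φ : X → TopologicalSpace.NonemptyCompacts M} {a : ℝ}

theorem dist_toCompletion_le_of_isAncestor (hV : IsVertical V o) (ha : 0 < a) {u x : X}
    (h : IsAncestor V o u x) :
    dist (toCompletion (intersectionGraph V o Φ) o a u)
      (toCompletion (intersectionGraph V o Φ) o a x) ≤ Real.exp (-a * level V o u) := by
  rw [dist_toCompletion]
  refine (gromovDist_le _ _).trans (Real.exp_le_exp.2 (mul_le_mul_of_nonpos_left ?_ (by linarith)))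
  have := le_gromovProduct_of_ancestors (Φ := Φ) (N := 0) hV Relation.ReflTransGen.refl h rfl rfl
    (by simp)
  simpa using this

theorem Ray.exists_convergesTo (hV : IsVertical V o)
    (ha : IsGromovParameter (intersectionGraph V o Φ) o a) (r : Ray V o) :
    ∃ ξ, ConvergesTo (intersectionGraph V o Φ) o a r.vertex ξ := by
  have hcauchy : CauchySeq fun i => toCompletion (intersectionGraph V o Φ) o a (r.vertex i) := by
    refine cauchySeq_of_le_tendsto_0' (fun n : ℕ => Real.exp (-a * n)) (fun n m hnm => ?_)
      (tendsto_exp_neg_mul_natCast ha.1)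
    have := dist_toCompletion_le_of_isAncestor (Φ := Φ) hV ha.1 (r.isAncestor hnm)
    rwa [r.level_vertex] at this
  obtain ⟨ξ, hξ⟩ := cauchySeq_tendsto_of_complete hcauchy
  refine ⟨⟨ξ, ?_⟩, hξ⟩
  rintro ⟨x, rfl⟩
  have h := eventually_eq_of_tendsto_toCompletion
    (connected_intersectionGraph (o := o) (Φ := Φ) hV.rooted) ha hξ
  obtain ⟨i, hi, hi'⟩ := (h.and (eventually_gt_atTop (level V o x))).exists
  have := r.level_vertex i
  rw [hi] at this
  omega

/-- Every boundary point is the limit of a ray: an ultrafilter of vertices converging to the point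
tends to infinity, as vertices are not boundary points and levels are finite. -/
theorem exists_ray_convergesTo (hV : IsVertical V o)
    (ha : IsGromovParameter (intersectionGraph V o Φ) o a)
    (ξ : boundary (intersectionGraph V o Φ) o a) :
    ∃ r : Ray V o, ConvergesTo (intersectionGraph V o Φ) o a r.vertex ξ := by
  set ι := toCompletion (intersectionGraph V o Φ) o a with hι
  have hdense : DenseRange ι := UniformSpace.Completion.denseRange_coe
    (α := GromovSpace (intersectionGraph V o Φ) o a)
  have hne : (comap ι (𝓝 ξ.1)).NeBot := by
    rw [comap_neBot_iff]
    intro t ht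
    obtain ⟨_, ht', x, rfl⟩ := mem_closure_iff_nhds.1 (hdense ξ.1) t ht
    exact ⟨x, ht'⟩
  let 𝓤 : Ultrafilter X := Ultrafilter.of (comap ι (𝓝 ξ.1))
  have hle : (𝓤 : Filter X) ≤ comap ι (𝓝 ξ.1) := Ultrafilter.of_le _
  have hlim : Tendsto ι 𝓤 (𝓝 ξ.1) := tendsto_comap.mono_left hle
  have hlevel : Tendsto (level V o) 𝓤 atTop := by
    refine tendsto_atTop.2 fun n => ?_
    have hfin := finite_setOf_level_le (o := o) hV.rooted n
    have h : ∀ᶠ x in (𝓤 : Filter X), ∀ y ∈ {x | level V o x ≤ n}, x ≠ y := by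
      rw [hfin.eventually_all]
      intro y _
      have hy : ξ.1 ≠ ι y := fun h => ξ.2 ⟨y, h.symm⟩
      filter_upwards [hlim.eventually (isOpen_ne.mem_nhds hy)] with x hx hxy
      exact hx (by rw [hxy])
    filter_upwards [h] with x hx
    by_contra hlt
    exact hx x (show level V o x ≤ n by omega) rfl
  obtain ⟨r, hr⟩ := exists_ray_of_ultrafilter hV.rooted 𝓤 hlevel
  refine ⟨r, tendsto_iff_dist_tendsto_zero.2 (squeeze_zero (fun _ => dist_nonneg) (fun n => ?_)
    (tendsto_exp_neg_mul_natCast ha.1))⟩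
  refine le_of_tendsto (tendsto_const_nhds.dist hlim) ?_
  filter_upwards [hr n] with x hx
  have := dist_toCompletion_le_of_isAncestor (Φ := Φ) hV ha.1 hx
  rwa [r.level_vertex] at this

/-- Rays with the same image under `κ₀` stay within distance one of each other, hence have the
same limit. -/
theorem ConvergesTo.of_kappaZero_eq (hV : IsVertical V o) (hΦ : IsIndexMap V o Φ) (ha : 0 < a)
    {r s : Ray V o} (h : kappaZero hΦ r = kappaZero hΦ s)
    {ξ : boundary (intersectionGraph V o Φ) o a}
    (hr : ConvergesTo (intersectionGraph V o Φ) o a r.vertex ξ) :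
    ConvergesTo (intersectionGraph V o Φ) o a s.vertex ξ := by
  refine (tendsto_iff_of_dist ?_).1 hr
  have hlim := (tendsto_exp_neg_mul_natCast ha).const_mul (Real.exp (a / 2))
  rw [mul_zero] at hlim
  refine squeeze_zero (fun _ => dist_nonneg) (fun n => ?_) hlim
  rw [dist_toCompletion, ← Real.exp_add]
  refine (gromovDist_le _ _).trans (Real.exp_le_exp.2 ?_)
  have h1 := le_gromovProduct_of_ancestors (Φ := Φ) (N := 1) hV Relation.ReflTransGen.refl
    Relation.ReflTransGen.refl (r.level_vertex n) (s.level_vertex n)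
    (dist_le_one_of_inter_nonempty ((r.level_vertex n).trans (s.level_vertex n).symm)
      ⟨_, mem_kappaZero hΦ r n, by rw [h]; exact mem_kappaZero hΦ s n⟩)
  push_cast at h1
  nlinarith

/-- The Hölder estimate for rays, from which it follows that `κ` is well defined. -/
theorem exists_dist_kappaZero_rpow_le (hV : IsVertical V o) (hΦ : IsIndexMap V o Φ) {b : ℝ}
    (hb : 0 < b) (hexp : IsExponentialType V o Φ b)
    (ha : IsGromovParameter (intersectionGraph V o Φ) o a) :
    ∃ C : ℝ, 0 < C ∧ ∀ (r s : Ray V o) (ξ η : boundary (intersectionGraph V o Φ) o a),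
      ConvergesTo (intersectionGraph V o Φ) o a r.vertex ξ →
      ConvergesTo (intersectionGraph V o Φ) o a s.vertex η →
        dist (kappaZero hΦ r) (kappaZero hΦ s) ^ (a / b) ≤ C * dist ξ η := by
  obtain ⟨C, hC, hdist⟩ := exists_dist_le_exp_gromovProduct hV hΦ hb hexp
  have ha0 := ha.1
  refine ⟨C ^ (a / b) * 2, by positivity, fun r s ξ η hr hs => ?_⟩
  -- The additional term covers the case of equal vertices, whose Gromov distance is zero.
  have key : ∀ n, dist (kappaZero hΦ r) (kappaZero hΦ s) ^ (a / b) ≤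
      C ^ (a / b) * (2 * dist (toCompletion (intersectionGraph V o Φ) o a (r.vertex n))
        (toCompletion (intersectionGraph V o Φ) o a (s.vertex n)) + Real.exp (-a * n)) := by
    intro n
    set g := gromovProduct (intersectionGraph V o Φ) o (r.vertex n) (s.vertex n) with hg
    have h1 : dist (kappaZero hΦ r) (kappaZero hΦ s) ≤ C * Real.exp (-b * g) :=
      hdist _ _ _ (mem_kappaZero hΦ r n) _ (mem_kappaZero hΦ s n)
    have h2 : (C * Real.exp (-b * g)) ^ (a / b) = C ^ (a / b) * Real.exp (-a * g) := by
      rw [Real.mul_rpow hC.le (Real.exp_pos _).le, ← Real.exp_mul]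
      congr 2
      field_simp
    refine (Real.rpow_le_rpow dist_nonneg h1 (by positivity)).trans ?_
    rw [h2, dist_toCompletion]
    refine mul_le_mul_of_nonneg_left ?_ (by positivity)
    by_cases hrs : r.vertex n = s.vertex n
    · have h3 : g = n := by
        rw [hg, ← hrs, gromovProduct, level_intersectionGraph hV, r.level_vertex]
        simp
      rw [h3, hrs, gromovDist_self]
      linarith
    · have h3 := ha.exp_le_two_mul_gromovDist hrs
      have h4 := Real.exp_pos (-a * n)
      linarith
  have hlim := (((hr.dist hs).const_mul 2).add (tendsto_exp_neg_mul_natCast ha0)).const_mul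
    (C ^ (a / b))
  have := ge_of_tendsto' hlim key
  rwa [add_zero, ← mul_assoc] at this

/-- The boundary statements for a fixed parameter `a`: rays are equivalent exactly if they have the
same image under `κ₀`, and `κ` is a bijection satisfying the Hölder estimate. -/
theorem exists_inducedMap (hV : IsVertical V o) (hΦ : IsIndexMap V o Φ) {b : ℝ}
    (hb : 0 < b) (hexp : IsExponentialType V o Φ b)
    (ha : IsGromovParameter (intersectionGraph V o Φ) o a) :
    (∀ r s : Ray V o, (∃ ξ, ConvergesTo (intersectionGraph V o Φ) o a r.vertex ξ ∧
        ConvergesTo (intersectionGraph V o Φ) o a s.vertex ξ) ↔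
      kappaZero hΦ r = kappaZero hΦ s) ∧
    ∃ κ : boundary (intersectionGraph V o Φ) o a → attractor V o Φ,
      IsInducedMap (intersectionGraph V o Φ) hΦ a κ ∧ Function.Bijective κ ∧
      ∃ C : ℝ, 0 < C ∧ ∀ ξ η, dist (κ ξ) (κ η) ^ (a / b) ≤ C * dist ξ η := by
  obtain ⟨C, hC, hest⟩ := exists_dist_kappaZero_rpow_le hV hΦ hb hexp ha
  have hab : a / b ≠ 0 := (div_pos ha.1 hb).ne'
  have hwd : ∀ (r s : Ray V o) ξ, ConvergesTo (intersectionGraph V o Φ) o a r.vertex ξ →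
      ConvergesTo (intersectionGraph V o Φ) o a s.vertex ξ →
      kappaZero hΦ r = kappaZero hΦ s := by
    intro r s ξ hr hs
    have h := hest r s ξ ξ hr hs
    rw [dist_self, mul_zero] at h
    have h0 := le_antisymm h (Real.rpow_nonneg dist_nonneg _)
    exact dist_eq_zero.1 ((Real.rpow_eq_zero dist_nonneg hab).1 h0)
  have hlim := fun r : Ray V o => r.exists_convergesTo (Φ := Φ) hV ha
  choose ρ hρ using exists_ray_convergesTo (Φ := Φ) hV ha
  refine ⟨fun r s => ⟨fun ⟨ξ, hr, hs⟩ => hwd r s ξ hr hs, fun h => ?_⟩,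
    fun ξ => kappaZero hΦ (ρ ξ), ⟨hlim, fun ξ => ⟨ρ ξ, hρ ξ⟩, fun r ξ hr => hwd _ _ ξ (hρ ξ) hr⟩,
    ⟨fun ξ η h => ?_, fun p => ?_⟩, C, hC, fun ξ η => hest _ _ ξ η (hρ ξ) (hρ η)⟩
  · obtain ⟨ξ, hξ⟩ := hlim r
    exact ⟨ξ, hξ, hξ.of_kappaZero_eq hV hΦ ha.1 h⟩
  · exact Subtype.ext (tendsto_nhds_unique ((hρ ξ).of_kappaZero_eq hV hΦ ha.1 h) (hρ η))
  · obtain ⟨r, rfl⟩ := kappaZero_surjective hV hΦ p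
    obtain ⟨ξ, hξ⟩ := hlim r
    exact ⟨ξ, hwd _ _ ξ (hρ ξ) hξ⟩

end IndexMaps

end AugmentedIndexGraph

theorem theorem5p4 {X : Type*} {M : Type*} [MetricSpace M] [CompleteSpace M]
    (V : SimpleGraph X) (o : X) (hV : AugmentedIndexGraph.IsVertical V o)
    (Φ : X → TopologicalSpace.NonemptyCompacts M)
    (hΦ : AugmentedIndexGraph.IsIndexMap V o Φ)
    (b : ℝ) (hb : 0 < b) (hexp : AugmentedIndexGraph.IsExponentialType V o Φ b)
    (hcond : AugmentedIndexGraph.ConditionS V o Φ b ∨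
      (AugmentedIndexGraph.IsDoubling (AugmentedIndexGraph.attractor V o Φ) ∧
        AugmentedIndexGraph.ConditionB V o Φ b)) :
    AugmentedIndexGraph.IsHyperbolic (AugmentedIndexGraph.intersectionGraph V o Φ) o ∧
    AugmentedIndexGraph.IsAdmissible V (AugmentedIndexGraph.intersectionGraph V o Φ) o Φ ∧
    ∀ a : ℝ, AugmentedIndexGraph.IsGromovParameter
        (AugmentedIndexGraph.intersectionGraph V o Φ) o a →
      ∃ κ : AugmentedIndexGraph.boundary (AugmentedIndexGraph.intersectionGraph V o Φ) o a →
          AugmentedIndexGraph.attractor V o Φ,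
        AugmentedIndexGraph.IsInducedMap
          (AugmentedIndexGraph.intersectionGraph V o Φ) hΦ a κ ∧
        Function.Bijective κ ∧
        ∃ C : ℝ, 0 < C ∧ ∀ ξ η, dist (κ ξ) (κ η) ^ (a / b) ≤ C * dist ξ η := by
  have hcell : AugmentedIndexGraph.HasDisjointCellBound V o Φ b :=
    hcond.elim (fun h => h.hasDisjointCellBound)
      fun h => h.2.hasDisjointCellBound hV.rooted hexp h.1
  have hhyp := AugmentedIndexGraph.isHyperbolic_intersectionGraph hV hΦ hb hexp hcell
  refine ⟨hhyp, ?_, fun a ha => (AugmentedIndexGraph.exists_inducedMap hV hΦ hb hexp ha).2⟩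
  exact
    { expansive := AugmentedIndexGraph.isExpansive_intersectionGraph hV hΦ
      hyperbolic := hhyp
      verticalPart_eq := AugmentedIndexGraph.verticalPart_intersectionGraph hV
      indexMap := hΦ
      equivalent_iff := fun a ha =>
        (AugmentedIndexGraph.exists_inducedMap hV hΦ hb hexp ha).1
      bijective := fun a ha => by
        obtain ⟨κ, h1, h2, -⟩ := (AugmentedIndexGraph.exists_inducedMap hV hΦ hb hexp ha).2
        exact ⟨κ, h1, h2⟩ }
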